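/- Let $F=GF(2^m)$, $n=2^m-1$, $0\le k\le n$, and let $\alpha\in F$ be a primitive element. For a word $w\in F^n$ put $\mathcal F(w)_l=\sum_{i=1}^n w_i\alpha^{il}$; the $(n,k)$ Reed–Solomon code is the set of words with $\mathcal F(w)_l=0$ for $0\le l<n-k$. Let $\hat z\in F^n$ be the hard decision, $w$ a codeword, $e=\hat z-w$ the error pattern, $I=\{i:e_i\ne0\}$, $E(x)=\sum_{l<n}\mathcal F(e)_l x^l$, $S(x)=\sum_{l<n-k}\mathcal F(\hat z)_l x^l$ (the syndrome polynomial), $\Lambda(x)=\prod_{i\in I}(1-\alpha^i x)$ and $\Omega$ the polynomial with $\Lambda E=\Omega(1-x^n)$. Run the Berlekamp algorithm for $n-k$ iterations: start with $\lambda=1,\ \delta=1,\ \omega=0,\ \kappa=x^{-1}$, $L_\lambda=0$, $L_{x\delta}=1$; in iteration $r=0,\dots,n-k-1$ let $\Delta$ be the coefficient of $x^r$ in $\lambda S$. If $\Delta\ne0$ and $L_\lambda<L_{x\delta}$, replace $(\lambda,\delta)$ by $(\lambda+\Delta x\delta,\Delta^{-1}\lambda)$ and $(L_\lambda,L_{x\delta})$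 by $(L_{x\delta},L_\lambda+1)$; otherwise replace $(\lambda,\delta)$ by $(\lambda+\Delta x\delta,x\delta)$ and $L_{x\delta}$ by $L_{x\delta}+1$; update $(\omega,\kappa)$ by the same rule as $(\lambda,\delta)$. If $L_\lambda\le L_{x\delta}$ at the end put $(a,c,L_a)=(\lambda,\omega,L_\lambda)$, $(b,d,L_b)=(x\delta,x\kappa,L_{x\delta})$; otherwise exchange the roles, so that $L_a\le L_b$. Let $\theta\in F\cup\{\infty\}$ be such that $f=b-\theta a$ (for $\theta=\infty$: $f=a$) has no root among $\alpha^{-1},\dots,\alpha^{-n}$. Put $h=-\frac{a}{b-\theta a}$, $\phi=\frac{bc-ad}{(b-\theta a)^2}$ if $\theta\ne\infty$, and $h=-\frac ba$, $\phi=\frac{ad-bc}{a^2}$ if $\theta=\infty$; for $x,\epsilon\neq0$ let $p(x,\epsilon)=-(\epsilon x)^{-1}\phi(x)+h'(x)$. Let $M(\alpha^{-i},\alpha^{-j})$, $1\le i,j\le n$, be non-negative integers, $C=\sum_{i=1}^n\sum_{j=1}^n \frac{M(\alpha^{-i},\alpha^{-j})(M(\alpha^{-i},\alpha^{-j})+1)}2$,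 and let $D_Y\ge0$ be an integer. Assume $\deg\Lambda\ge L_b$, $$\frac{C+1}{D_Y+1}+D_Y\Bigl(\deg\Lambda-\frac{3L_a+L_b+1}4\Bigr)\le\sum_{i\in I}M(\alpha^{-i},e_i)\quad\text{and}\quad \frac{(L_b+1-L_a)D_Y(D_Y+1)}4\le C+1 .$$ Then there is exactly one pair of polynomials $u,v$ with $\Lambda=au+bv$, $\Omega=cu+dv$, $\deg u\le\deg\Lambda-L_a$, $\deg v\le\deg\Lambda-L_b$ (where $\deg 0=-\infty$), $u,v$ co-prime, and the cofactor of $\lambda$ (that is, $u$ if $a=\lambda$, $v$ if $b=\lambda$) equal to $1$ at $0$. With $g=\frac{v}{u+\theta v}$ if $\theta\ne\infty$ and $g=\frac uv$ if $\theta=\infty$, there exists a non-zero polynomial $Q(x,y)\in F[x,y]$ of $y$-degree at most $D_Y$ that passes through $\bigl(\alpha^{-i},\sqrt{p(\alpha^{-i},\alpha^{-j})}\bigr)$ with multiplicity (at least) $M(\alpha^{-i},\alpha^{-j})$ for all $i,j\in\{1,\dots,n\}$, and $g'$ is a square in $F(x)$ with $Q(x,\sqrt{g'(x)})=0$. -/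

import Mathlib

open Polynomial

namespace RSDecoding

noncomputable section

/-! ### Reed–Solomon codes in the frequency domain

`F` is a finite field, `α` a primitive `n`-th root of unity of `F`, `n = |F| - 1`.
A word of length `n` is a function `Fin n → F`; the entry with index `i : Fin n` stands at
location number `i + 1 ∈ {1, …, n}`. -/

/-- The point `α ^ (-i)` of location number `i ∈ {1, …, n}`; the index `i : Fin n` encodes the
location number `i + 1`.  As `i` varies this runs through all non-zero elements of the field. -/
def pt {F : Type*} [Field F] {n : ℕ} (α : F) (i : Fin n) : F := (α ^ (i.val + 1))⁻¹

/-- The `l`-th Fourier coefficient `∑ i, wᵢ α^{i l}` of a word (location numbers `1, …, n`). -/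
def fourierCoeff {F : Type*} [Field F] {n : ℕ} (α : F) (w : Fin n → F) (l : ℕ) : F :=
  ∑ i : Fin n, w i * α ^ ((i.val + 1) * l)

/-- The polynomial `∑_{l < N} E_l x^l` of the first `N` Fourier coefficients of a word.
For `N = n` this is the full Fourier transform, for `N = n - k` the syndrome polynomial. -/
def fourierPoly {F : Type*} [Field F] {n : ℕ} (α : F) (w : Fin n → F) (N : ℕ) : F[X] :=
  ∑ l ∈ Finset.range N, C (fourierCoeff α w l) * X ^ l

/-- The `(n, k)` Reed–Solomon code: the words whose first `n - k` Fourier coefficients vanish. -/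
def rsCode {F : Type*} [Field F] (n k : ℕ) (α : F) : Set (Fin n → F) :=
  {w | ∀ l < n - k, fourierCoeff α w l = 0}

/-- The set `I` of error locations of an error pattern. -/
def errorSet {F : Type*} [Field F] {n : ℕ} (e : Fin n → F) : Finset (Fin n) := by
  classical exact Finset.univ.filter fun i => e i ≠ 0

/-- The error locator polynomial `Λ = ∏_{i ∈ I} (1 - α^i x)`. -/
def locator {F : Type*} [Field F] {n : ℕ} (α : F) (e : Fin n → F) : F[X] :=
  ∏ i ∈ errorSet e, (1 - C (α ^ (i.val + 1)) * X)

/-- The error evaluator polynomial `Ω`, given by `Λ E = Ω (1 - x^n)` with `E` the Fourier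
transform of the error pattern (the division is exact). -/
def evaluator {F : Type*} [Field F] {n : ℕ} (α : F) (e : Fin n → F) : F[X] :=
  locator α e * fourierPoly α e n / (1 - X ^ n)

/-! ### The Berlekamp algorithm -/

/-- A shift register: a connection polynomial, the companion polynomial that Berlekamp's algorithm
updates by the same rule, and the length of the register. -/
structure Register (F : Type*) [Field F] where
  conn : F[X]
  comp : F[X]
  len : ℕ

/-- One iteration, processing the syndrome `S_r` (`r` counted from `0`).  The state is
`((λ, ω, L_λ), (xδ, xκ, L_{xδ}))`.  With the discrepancy `Δ`, the coefficient of `x^r` in `λ S`: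
* if `Δ ≠ 0` and `L_λ < L_{xδ}`, then `(λ, δ) ← (λ + Δ xδ, Δ⁻¹ λ)` with a length change;
* otherwise `(λ, δ) ← (λ + Δ xδ, xδ)`;
and `(ω, κ)` follows the same rule.  (The field has characteristic two, so signs play no role.) -/
def berlekampStep {F : Type*} [Field F] (S : F[X]) (r : ℕ) (s : Register F × Register F) :
    Register F × Register F := by
  classical exact
  let Δ : F := (s.1.conn * S).coeff r
  if Δ ≠ 0 ∧ s.1.len < s.2.len then
    (⟨s.1.conn + C Δ * s.2.conn, s.1.comp + C Δ * s.2.comp, s.2.len⟩,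
      ⟨X * (C Δ⁻¹ * s.1.conn), X * (C Δ⁻¹ * s.1.comp), s.1.len + 1⟩)
  else
    (⟨s.1.conn + C Δ * s.2.conn, s.1.comp + C Δ * s.2.comp, s.1.len⟩,
      ⟨X * s.2.conn, X * s.2.comp, s.2.len + 1⟩)

/-- The state after `r` iterations, started from `λ = 1`, `δ = 1`, `ω = 0`, `κ = x⁻¹`
(so `xδ = x`, `xκ = 1`) with `L_λ = 0`, `L_{xδ} = 1`. -/
def berlekamp {F : Type*} [Field F] (S : F[X]) : ℕ → Register F × Register F
  | 0 => (⟨1, 0, 0⟩, ⟨X, 1, 1⟩)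
  | r + 1 => berlekampStep S r (berlekamp S r)

/-- The pair `((a, c, L_a), (b, d, L_b))`: the two output registers `(λ, ω, L_λ)` and
`(xδ, xκ, L_{xδ})` of Berlekamp's algorithm after `N` iterations, in this order if
`L_λ ≤ L_{xδ}` and in the opposite order otherwise; thus `L_a ≤ L_b`. -/
def sortedRegisters {F : Type*} [Field F] (S : F[X]) (N : ℕ) : Register F × Register F :=
  if (berlekamp S N).1.len ≤ (berlekamp S N).2.len then berlekamp S N else (berlekamp S N).swap

/-- `u`, `v` are the polynomials through which the error locator and the error evaluator are
expressed by the output of the algorithm: `Λ = a u + b v` and `Ω = c u + d v`, with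
`deg u ≤ deg Λ - L_a`, `deg v ≤ deg Λ - L_b` (the zero polynomial has degree `-∞`),
`u` and `v` co-prime, and the cofactor of `λ` (the connection polynomial among `a`, `b` with
non-zero constant term) normalised to have constant term `1`. -/
structure IsDecomposition {F : Type*} [Field F] (A B : Register F) (Λ Ω u v : F[X]) : Prop where
  locator_eq : Λ = A.conn * u + B.conn * v
  evaluator_eq : Ω = A.comp * u + B.comp * v
  degree_left : u.degree + (A.len : WithBot ℕ) ≤ Λ.degree
  degree_right : v.degree + (B.len : WithBot ℕ) ≤ Λ.degree
  coprime : IsCoprime u v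
  norm_left : A.conn.coeff 0 ≠ 0 → u.coeff 0 = 1
  norm_right : B.conn.coeff 0 ≠ 0 → v.coeff 0 = 1

/-! ### Interpolation points -/

/-- `f = b - θ a` for `θ ∈ F`, and `f = a` for `θ = ∞`. -/
def fPoly {F : Type*} [Field F] (A B : Register F) : OnePoint F → F[X]
  | OnePoint.infty => A.conn
  | OnePoint.some t => B.conn - C t * A.conn

/-- `g = v / (u + θ v)` for `θ ∈ F`, and `g = u / v` for `θ = ∞`. -/
def gFun {F : Type*} [Field F] (u v : F[X]) : OnePoint F → RatFunc F
  | OnePoint.infty => algebraMap F[X] (RatFunc F) u / algebraMap F[X] (RatFunc F) v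
  | OnePoint.some t => algebraMap F[X] (RatFunc F) v / algebraMap F[X] (RatFunc F) (u + C t * v)

/-- `h = -a / (b - θ a)` for `θ ∈ F`, and `h = -b / a` for `θ = ∞`. -/
def hFun {F : Type*} [Field F] (A B : Register F) : OnePoint F → RatFunc F
  | OnePoint.infty =>
      -algebraMap F[X] (RatFunc F) B.conn / algebraMap F[X] (RatFunc F) A.conn
  | OnePoint.some t =>
      -algebraMap F[X] (RatFunc F) A.conn / algebraMap F[X] (RatFunc F) (B.conn - C t * A.conn)

/-- `φ = (b c - a d) / (b - θ a)²` for `θ ∈ F`, and `φ = (a d - b c) / a²` for `θ = ∞`. -/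
def phiFun {F : Type*} [Field F] (A B : Register F) : OnePoint F → RatFunc F
  | OnePoint.infty =>
      algebraMap F[X] (RatFunc F) (A.conn * B.comp - B.conn * A.comp) /
        algebraMap F[X] (RatFunc F) A.conn ^ 2
  | OnePoint.some t =>
      algebraMap F[X] (RatFunc F) (B.conn * A.comp - A.conn * B.comp) /
        algebraMap F[X] (RatFunc F) (B.conn - C t * A.conn) ^ 2

/-- The formal derivative of a rational function (quotient rule). -/
def ratDeriv {F : Type*} [Field F] (r : RatFunc F) : RatFunc F :=
  algebraMap F[X] (RatFunc F) (derivative r.num * r.denom - r.num * derivative r.denom) /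
    algebraMap F[X] (RatFunc F) r.denom ^ 2

/-- The value at `x` of a rational function without pole at `x`. -/
def ratEval {F : Type*} [Field F] (x : F) (r : RatFunc F) : F := r.eval (RingHom.id F) x

/-- `p(x, e) = -(e x)⁻¹ φ(x) + h'(x)`, for `e ≠ 0` and `x ≠ 0`. -/
def pFun {F : Type*} [Field F] (A B : Register F) (θ : OnePoint F) (x e : F) : F :=
  -(e * x)⁻¹ * ratEval x (phiFun A B θ) + ratEval x (ratDeriv (hFun A B θ))

/-- The bivariate polynomial `Q(x, y)`, an element of `F[x][y]`, passes through `(x₀, y₀)` with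
multiplicity (at least) `r`: `Q(x + x₀, y + y₀)` has no monomial of total degree less than `r`. -/
def HasMultiplicity {F : Type*} [Field F] (Q : F[X][X]) (x₀ y₀ : F) (r : ℕ) : Prop :=
  ∀ s t : ℕ, s + t < r →
    (((Q.map (compRingHom (X + C x₀))).comp (X + C (C y₀))).coeff t).coeff s = 0

/-- The cost `C = ∑ᵢ ∑ⱼ M(α^{-i}, α^{-j}) (M(α^{-i}, α^{-j}) + 1) / 2`. -/
def cost {F : Type*} [Field F] (n : ℕ) (α : F) (M : F → F → ℕ) : ℚ :=
  ∑ i : Fin n, ∑ j : Fin n, (M (pt α i) (pt α j) : ℚ) * ((M (pt α i) (pt α j) : ℚ) + 1) / 2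

end

end RSDecoding

open RSDecoding

namespace RSDecoding

/-! ### Invariants of the Berlekamp algorithm -/

/-! The two registers form a matrix with determinant x^N, N = n - k, whose rows solve the key
equation modulo x^N (`BerlekampInvariant`). Since Λ and Ω solve it too, Cramer's rule divides
exactly by x^N and yields polynomial cofactors u, v (`IsOutput.exists_cofactors`); the register
lengths bound their degrees, and invertibility of the matrix makes them unique.

At an error location Λ vanishes, so the unknown function g agrees there with the known function h.
Differentiating Λ = au + bv and inserting Forney's formula shows that g' takes the value p(x, e_i)
there (`deriv_quotient_eq`). In characteristic two, writing g = V/U gives g' = (VU)'/U², and (VU)'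
is a square W² (`exists_sq_eq_derivative`). So √g' = W/U passes through the points (α^{-i},
√p(α^{-i}, e_i)), and deg W is at most half of deg U + deg V - 1: the root is a simpler target than
g itself.

The rest is a Guruswami–Sudan argument (`exists_interpolation_aeval_eq_zero`). Let J be the total
multiplicity on the graph of W/U. The degrees of the coefficients q_j of Q are limited so that ∑ q_j
W^j U^{D-j} has degree below J. This sum has zeros of total order at least J, hence is zero. Summing
the allowed numbers of coefficients gives the assumed inequality, with deg Λ - (3L_a + L_b + 1)/4 as
the mean of the bounds for deg U and deg W. -/

/-- The degree bounds of a register in terms of its length. -/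
structure Register.IsBounded {F : Type*} [Field F] (R : Register F) : Prop where
  conn_le : R.conn.degree ≤ (R.len : WithBot ℕ)
  comp_lt : R.comp.degree < (R.len : WithBot ℕ)

/-- The invariants of the state `((λ, ω, L_λ), (xδ, xκ, L_{xδ}))` after `r` iterations. -/
structure BerlekampInvariant {F : Type*} [Field F] (S : F[X]) (r : ℕ)
    (s : Register F × Register F) : Prop where
  len_add : s.1.len + s.2.len = r + 1
  one_le : 1 ≤ s.2.len
  bounded_fst : s.1.IsBounded
  bounded_snd : s.2.IsBounded
  det : s.1.conn * s.2.comp + s.1.comp * s.2.conn = X ^ r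
  key_fst : X ^ r ∣ s.1.conn * S + s.1.comp
  key_snd : X ^ (r + 1) ∣ s.2.conn * S + s.2.comp + X ^ r
  coeff_fst : s.1.conn.coeff 0 = 1
  coeff_snd : s.2.conn.coeff 0 = 0

theorem Register.IsBounded.mono {F : Type*} [Field F] {R : Register F} (h : R.IsBounded) {L : ℕ}
    (hL : R.len ≤ L) : (⟨R.conn, R.comp, L⟩ : Register F).IsBounded :=
  ⟨h.conn_le.trans (by exact_mod_cast hL), h.comp_lt.trans_le (by exact_mod_cast hL)⟩

theorem degree_C_mul_le_degree {F : Type*} [Field F] (c : F) (p : F[X]) :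
    (C c * p).degree ≤ p.degree := by
  rw [← smul_eq_C_mul]; exact degree_smul_le c p

theorem Register.IsBounded.add_C_mul {F : Type*} [Field F] {p q p' q' : F[X]} {L : ℕ}
    (h : (⟨p, q, L⟩ : Register F).IsBounded) (h' : (⟨p', q', L⟩ : Register F).IsBounded) (c : F) :
    (⟨p + C c * p', q + C c * q', L⟩ : Register F).IsBounded :=
  ⟨(degree_add_le _ _).trans (max_le h.conn_le ((degree_C_mul_le_degree _ _).trans h'.conn_le)),
    (degree_add_le _ _).trans_lt
      (max_lt h.comp_lt ((degree_C_mul_le_degree _ _).trans_lt h'.comp_lt))⟩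

theorem Register.IsBounded.C_mul {F : Type*} [Field F] {p q : F[X]} {L : ℕ}
    (h : (⟨p, q, L⟩ : Register F).IsBounded) (c : F) :
    (⟨C c * p, C c * q, L⟩ : Register F).IsBounded :=
  ⟨(degree_C_mul_le_degree _ _).trans h.conn_le, (degree_C_mul_le_degree _ _).trans_lt h.comp_lt⟩

theorem Register.IsBounded.X_mul {F : Type*} [Field F] {p q : F[X]} {L : ℕ}
    (h : (⟨p, q, L⟩ : Register F).IsBounded) :
    (⟨X * p, X * q, L + 1⟩ : Register F).IsBounded := by
  obtain ⟨h1, h2⟩ := h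
  constructor
  · simp only [degree_mul, degree_X, Nat.cast_add, Nat.cast_one] at h1 ⊢
    rw [add_comm]
    gcongr
  · simp only [degree_mul, degree_X, Nat.cast_add, Nat.cast_one] at h2 ⊢
    rw [add_comm]
    exact WithBot.add_lt_add_right (by simp) h2

theorem two_eq_zero_of_charTwo {F : Type*} [Field F] [CharP F 2] : (2 : F[X]) = 0 :=
  CharTwo.two_eq_zero

theorem berlekampInvariant_zero {F : Type*} [Field F] [CharP F 2] (S : F[X]) :
    BerlekampInvariant S 0 (berlekamp S 0) where
  len_add := rfl
  one_le := le_rfl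
  bounded_fst := ⟨by simp [berlekamp], by simp [berlekamp]⟩
  bounded_snd := ⟨by simp [berlekamp], by simp [berlekamp]⟩
  det := by simp [berlekamp]
  key_fst := by simp [berlekamp]
  key_snd := by
    have h := two_eq_zero_of_charTwo (F := F)
    exact ⟨S, by simp only [berlekamp]; linear_combination h⟩
  coeff_fst := by simp [berlekamp]
  coeff_snd := by simp [berlekamp]

/-- The lengths add up to r + 1 and the second is positive, so deg ω < L_λ ≤ r. Hence ω does not
contribute at x^r, and the first residue of the key equation is the discrepancy. -/
theorem BerlekampInvariant.X_pow_dvd_sub {F : Type*} [Field F] {S : F[X]} {r : ℕ}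
    {s : Register F × Register F} (h : BerlekampInvariant S r s) :
    X ^ (r + 1) ∣ s.1.conn * S + s.1.comp - C ((s.1.conn * S).coeff r) * X ^ r := by
  rw [X_pow_dvd_iff]
  intro d hd
  rcases Nat.lt_succ_iff_lt_or_eq.mp hd with hlt | rfl
  · have := (X_pow_dvd_iff.mp h.key_fst) d hlt
    rw [coeff_sub, this, coeff_C_mul, coeff_X_pow, if_neg hlt.ne]
    simp
  · have h0 : s.1.comp.coeff d = 0 := by
      apply coeff_eq_zero_of_degree_lt
      refine h.bounded_fst.comp_lt.trans_le ?_
      have := h.len_add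
      have := h.one_le
      exact_mod_cast (by omega : s.1.len ≤ d)
    simp [h0]

theorem BerlekampInvariant.step {F : Type*} [Field F] [CharP F 2] {S : F[X]} {r : ℕ}
    {s : Register F × Register F} (h : BerlekampInvariant S r s) :
    BerlekampInvariant S (r + 1) (berlekampStep S r s) := by
  have two := two_eq_zero_of_charTwo (F := F)
  obtain ⟨w, hw⟩ := h.X_pow_dvd_sub
  obtain ⟨w', hw'⟩ := h.key_snd
  have hlen := h.len_add
  have hone := h.one_le
  have hdet := h.det
  unfold berlekampStep
  set Δ := (s.1.conn * S).coeff r with hΔ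
  -- The residue Δ x^r of λ is cancelled by Δ times the residue -x^r of xδ.
  have hkey : (s.1.conn + C Δ * s.2.conn) * S + (s.1.comp + C Δ * s.2.comp)
      = X ^ (r + 1) * (w + C Δ * w') := by
    linear_combination hw + C Δ * hw'
  by_cases hc : Δ ≠ 0 ∧ s.1.len < s.2.len
  · have hC : C Δ * C Δ⁻¹ = (1 : F[X]) := by rw [← C_mul, mul_inv_cancel₀ hc.1, C_1]
    simp only [if_pos hc]
    refine ⟨?_, ?_, ?_, ?_, ?_, ?_, ?_, ?_, ?_⟩
    · simp only; omega
    · simp only; omega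
    · exact (h.bounded_fst.mono hc.2.le).add_C_mul h.bounded_snd Δ
    · exact (h.bounded_fst.C_mul Δ⁻¹).X_mul
    · simp only
      linear_combination (X * (C Δ * C Δ⁻¹)) * hdet + X ^ (r + 1) * hC
        + (X * C Δ⁻¹ * s.1.conn * s.1.comp) * two
    · exact ⟨_, hkey⟩
    -- Scaling by Δ⁻¹ normalises the residue of the old λ to x^r, and the shift by x moves it to
    -- x^(r+1).
    · refine ⟨C Δ⁻¹ * w, ?_⟩
      simp only
      linear_combination X * C Δ⁻¹ * hw + X ^ (r + 1) * hC + X ^ (r + 1) * two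
    · simp [h.coeff_fst, h.coeff_snd]
    · simp
  · simp only [if_neg hc]
    refine ⟨?_, ?_, ?_, ?_, ?_, ?_, ?_, ?_, ?_⟩
    · simp only; omega
    · simp only; omega
    · by_cases h0 : Δ = 0
      · simpa [h0] using h.bounded_fst
      -- A non-zero discrepancy without length change means that xδ already fits into the length of
      -- λ.
      · have : s.2.len ≤ s.1.len := by
          by_contra hlt
          exact hc ⟨h0, not_le.mp hlt⟩
        exact h.bounded_fst.add_C_mul (h.bounded_snd.mono this) Δ
    · exact h.bounded_snd.X_mul
    · simp only
      linear_combination X * hdet + (X * C Δ * s.2.conn * s.2.comp) * two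
    · exact ⟨_, hkey⟩
    · refine ⟨w', ?_⟩
      simp only
      linear_combination X * hw'
    · simp [h.coeff_fst, h.coeff_snd]
    · simp

theorem berlekampInvariant {F : Type*} [Field F] [CharP F 2] (S : F[X]) (r : ℕ) :
    BerlekampInvariant S r (berlekamp S r) := by
  induction r with
  | zero => exact berlekampInvariant_zero S
  | succ r ih => exact ih.step

/-- The properties of the sorted output of the Berlekamp algorithm. -/
structure IsOutput {F : Type*} [Field F] (S : F[X]) (N : ℕ) (A B : Register F) : Prop where
  len_add : A.len + B.len = N + 1
  len_le : A.len ≤ B.len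
  bounded_left : A.IsBounded
  bounded_right : B.IsBounded
  det : A.conn * B.comp + A.comp * B.conn = X ^ N
  key_left : X ^ N ∣ A.conn * S + A.comp
  key_right : X ^ N ∣ B.conn * S + B.comp
  coeff_zero : A.conn.coeff 0 = 1 ∧ B.conn.coeff 0 = 0 ∨ A.conn.coeff 0 = 0 ∧ B.conn.coeff 0 = 1

theorem isOutput_sortedRegisters {F : Type*} [Field F] [CharP F 2] (S : F[X]) (N : ℕ) :
    IsOutput S N (sortedRegisters S N).1 (sortedRegisters S N).2 := by
  have h := berlekampInvariant S N
  have hk : X ^ N ∣ (berlekamp S N).2.conn * S + (berlekamp S N).2.comp :=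
    (dvd_add_left dvd_rfl).mp ((pow_dvd_pow X N.le_succ).trans h.key_snd)
  unfold sortedRegisters
  split_ifs with hle
  · exact ⟨h.len_add, hle, h.bounded_fst, h.bounded_snd, h.det, h.key_fst, hk,
      Or.inl ⟨h.coeff_fst, h.coeff_snd⟩⟩
  · refine ⟨?_, (not_le.mp hle).le, h.bounded_snd, h.bounded_fst, ?_, hk, h.key_fst,
      Or.inr ⟨h.coeff_snd, h.coeff_fst⟩⟩
    · rw [← h.len_add, add_comm]; rfl
    · rw [← h.det]; simp only [Prod.fst_swap, Prod.snd_swap]; ring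

/-! ### Error locator and error evaluator -/

theorem pt_ne_zero {F : Type*} [Field F] {n : ℕ} {α : F} (hα : IsPrimitiveRoot α n) (i : Fin n) :
    pt α i ≠ 0 :=
  inv_ne_zero (pow_ne_zero _ (hα.ne_zero (Fin.pos i).ne'))

theorem pow_mul_pt {F : Type*} [Field F] {n : ℕ} {α : F} (hα : IsPrimitiveRoot α n) (i : Fin n) :
    α ^ (i.val + 1) * pt α i = 1 :=
  mul_inv_cancel₀ (pow_ne_zero _ (hα.ne_zero (Fin.pos i).ne'))

theorem pt_injective {F : Type*} [Field F] {n : ℕ} {α : F} (hα : IsPrimitiveRoot α n) :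
    Function.Injective (pt α : Fin n → F) := by
  intro i j hij
  have h := inv_injective hij
  rw [pow_succ, pow_succ] at h
  exact Fin.ext (hα.pow_inj i.2 j.2 (mul_right_cancel₀ (hα.ne_zero (Fin.pos i).ne') h))

theorem exists_pt_eq {F : Type*} [Field F] [Fintype F] {n : ℕ} {α : F}
    (hα : IsPrimitiveRoot α n) (hn : n = Fintype.card F - 1) (hn0 : n ≠ 0) {x : F} (hx : x ≠ 0) :
    ∃ i : Fin n, pt α i = x := by
  have hα0 := hα.ne_zero hn0
  have : NeZero n := ⟨hn0⟩
  -- The extra factor α accounts for the index i standing for location i + 1.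
  obtain ⟨i, hi, h⟩ := hα.eq_pow_of_pow_eq_one (ξ := (x * α)⁻¹)
    (by rw [hn]; exact FiniteField.pow_card_sub_one_eq_one _ (inv_ne_zero (mul_ne_zero hx hα0)))
  refine ⟨⟨i, hi⟩, ?_⟩
  simp only [pt]
  rw [pow_succ, h]
  field_simp

theorem mem_errorSet {F : Type*} [Field F] {n : ℕ} {e : Fin n → F} {i : Fin n} :
    i ∈ errorSet e ↔ e i ≠ 0 := by
  simp [errorSet]

/-- The error locator with the factor of one location removed. -/
noncomputable def locatorErase {F : Type*} [Field F] {n : ℕ} (α : F) (e : Fin n → F)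
    (i : Fin n) : F[X] :=
  ∏ j ∈ (errorSet e).erase i, (1 - C (α ^ (j.val + 1)) * X)

theorem locator_eq_mul_locatorErase {F : Type*} [Field F] {n : ℕ} (α : F) {e : Fin n → F}
    {i : Fin n} (hi : i ∈ errorSet e) :
    locator α e = (1 - C (α ^ (i.val + 1)) * X) * locatorErase α e i :=
  (Finset.mul_prod_erase _ _ hi).symm

theorem geom_fourier {F : Type*} [Field F] {n : ℕ} {α : F} (hα : IsPrimitiveRoot α n)
    (i : Fin n) :
    (1 - C (α ^ (i.val + 1)) * X) * ∑ l ∈ Finset.range n, (C (α ^ (i.val + 1)) * X) ^ l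
      = 1 - X ^ n := by
  rw [mul_neg_geom_sum, mul_pow, ← C_pow, ← pow_mul, mul_comm (i.val + 1), pow_mul, hα.pow_eq_one]
  simp

theorem fourierPoly_eq_sum {F : Type*} [Field F] {n : ℕ} (α : F) (e : Fin n → F) (N : ℕ) :
    fourierPoly α e N
      = ∑ i ∈ errorSet e, C (e i) * ∑ l ∈ Finset.range N, (C (α ^ (i.val + 1)) * X) ^ l := by
  have h : ∀ i ∈ Finset.univ, i ∉ errorSet e →
      C (e i) * ∑ l ∈ Finset.range N, (C (α ^ (i.val + 1)) * X) ^ l = 0 := by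
    intro i _ hi
    rw [mem_errorSet, not_not] at hi
    simp [hi]
  rw [Finset.sum_subset (Finset.subset_univ _) h]
  simp only [fourierPoly, fourierCoeff, map_sum, Finset.sum_mul, Finset.mul_sum]
  rw [Finset.sum_comm]
  refine Finset.sum_congr rfl fun i _ => Finset.sum_congr rfl fun l _ => ?_
  rw [mul_pow, ← C_pow, ← pow_mul, C_mul]
  ring

/-- Each error contributes a finite geometric series, whose denominator is a factor of Λ. This
proves that the division defining Ω is exact and gives Ω as a sum over the errors. -/
theorem locator_mul_fourierPoly {F : Type*} [Field F] {n : ℕ} {α : F}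
    (hα : IsPrimitiveRoot α n) (e : Fin n → F) :
    locator α e * fourierPoly α e n
      = (∑ i ∈ errorSet e, C (e i) * locatorErase α e i) * (1 - X ^ n) := by
  rw [fourierPoly_eq_sum, Finset.mul_sum, Finset.sum_mul]
  refine Finset.sum_congr rfl fun i hi => ?_
  rw [locator_eq_mul_locatorErase α hi]
  linear_combination (C (e i) * locatorErase α e i) * geom_fourier hα i

theorem evaluator_eq_sum {F : Type*} [Field F] {n : ℕ} {α : F} (hn0 : n ≠ 0)
    (hα : IsPrimitiveRoot α n) (e : Fin n → F) :
    evaluator α e = ∑ i ∈ errorSet e, C (e i) * locatorErase α e i := by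
  have h : (1 - X ^ n : F[X]) ≠ 0 := by
    rw [← neg_ne_zero, neg_sub]
    exact X_pow_sub_C_ne_zero (Nat.pos_of_ne_zero hn0) (1 : F)
  rw [evaluator, locator_mul_fourierPoly hα, mul_div_cancel_right₀ _ h]

theorem locator_mul_fourierPoly_eq_evaluator {F : Type*} [Field F] {n : ℕ} {α : F} (hn0 : n ≠ 0)
    (hα : IsPrimitiveRoot α n) (e : Fin n → F) :
    locator α e * fourierPoly α e n = evaluator α e * (1 - X ^ n) := by
  rw [locator_mul_fourierPoly hα, evaluator_eq_sum hn0 hα]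

theorem degree_one_sub_C_mul_X {F : Type*} [Field F] {c : F} (hc : c ≠ 0) :
    (1 - C c * X : F[X]).degree = 1 := by
  have h : (1 - C c * X : F[X]) = C (-c) * X + C 1 := by
    rw [C_neg, C_1]; ring
  rw [h, degree_linear (neg_ne_zero.mpr hc)]

theorem degree_locator {F : Type*} [Field F] {n : ℕ} {α : F} (hn0 : n ≠ 0)
    (hα : IsPrimitiveRoot α n) (e : Fin n → F) :
    (locator α e).degree = ((errorSet e).card : WithBot ℕ) := by
  rw [locator, degree_prod, Finset.sum_congr rfl fun i _ =>
    degree_one_sub_C_mul_X (pow_ne_zero _ (hα.ne_zero hn0))]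
  simp

theorem degree_evaluator_lt {F : Type*} [Field F] {n : ℕ} {α : F} (hn0 : n ≠ 0)
    (hα : IsPrimitiveRoot α n) (e : Fin n → F) :
    (evaluator α e).degree < ((errorSet e).card : WithBot ℕ) := by
  rw [evaluator_eq_sum hn0 hα, degree_lt_iff_coeff_zero]
  intro d hd
  rw [finsetSum_coeff]
  refine Finset.sum_eq_zero fun i hi => ?_
  rw [coeff_C_mul, coeff_eq_zero_of_degree_lt, mul_zero]
  rw [locatorErase, degree_prod, Finset.sum_congr rfl fun i _ =>
    degree_one_sub_C_mul_X (pow_ne_zero _ (hα.ne_zero hn0))]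
  have := Finset.card_pos.mpr ⟨i, hi⟩
  simp only [Finset.sum_const, Finset.card_erase_of_mem hi, nsmul_eq_mul, mul_one]
  exact_mod_cast (by omega : (errorSet e).card - 1 < d)

theorem eval_locatorErase_ne_zero {F : Type*} [Field F] {n : ℕ} {α : F}
    (hα : IsPrimitiveRoot α n) (e : Fin n → F) (i : Fin n) :
    (locatorErase α e i).eval (pt α i) ≠ 0 := by
  rw [locatorErase, eval_prod, Finset.prod_ne_zero_iff]
  intro j hj h
  have hij : pt α i = pt α j := by
    have h' : α ^ (j.val + 1) * pt α i = 1 := by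
      have h0 : 1 - α ^ (j.val + 1) * pt α i = 0 := by simpa using h
      exact (sub_eq_zero.mp h0).symm
    exact mul_left_cancel₀ (pow_ne_zero _ (hα.ne_zero (Fin.pos i).ne'))
      (h'.trans (pow_mul_pt hα j).symm)
  exact (Finset.mem_erase.mp hj).1 (pt_injective hα hij).symm

theorem eval_locator {F : Type*} [Field F] {n : ℕ} {α : F}
    (hα : IsPrimitiveRoot α n) {e : Fin n → F} {i : Fin n} (hi : i ∈ errorSet e) :
    (locator α e).eval (pt α i) = 0 := by
  rw [locator_eq_mul_locatorErase α hi]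
  simp [pow_mul_pt hα]

theorem eval_evaluator {F : Type*} [Field F] {n : ℕ} {α : F}
    (hα : IsPrimitiveRoot α n) {e : Fin n → F} {i : Fin n} (hi : i ∈ errorSet e) :
    (evaluator α e).eval (pt α i) = e i * (locatorErase α e i).eval (pt α i) := by
  rw [evaluator_eq_sum (Fin.pos i).ne' hα, eval_finsetSum, Finset.sum_eq_single_of_mem i hi]
  · simp
  · intro j hj hji
    rw [eval_mul, locatorErase, eval_prod,
      Finset.prod_eq_zero (Finset.mem_erase.mpr ⟨hji.symm, hi⟩), mul_zero]
    simp [pow_mul_pt hα]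

/-- Forney's formula. -/
theorem forney {F : Type*} [Field F] {n : ℕ} {α : F}
    (hα : IsPrimitiveRoot α n) {e : Fin n → F} {i : Fin n} (hi : i ∈ errorSet e) :
    e i * pt α i * (derivative (locator α e)).eval (pt α i)
      = -(evaluator α e).eval (pt α i) := by
  rw [eval_evaluator hα hi, locator_eq_mul_locatorErase α hi]
  have h := pow_mul_pt hα i
  simp only [derivative_mul, derivative_sub, derivative_one, derivative_C, derivative_X, eval_add,
    eval_mul, eval_sub, eval_one, eval_C, eval_X, eval_zero]
  linear_combination (-(e i * (locatorErase α e i).eval (pt α i))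
    - e i * pt α i * (derivative (locatorErase α e i)).eval (pt α i)) * h

/-- At a root of Λ only one summand of Ω survives, and it is a non-zero multiple of the error value.
-/
theorem isCoprime_locator_evaluator {F : Type*} [Field F] {n : ℕ} {α : F}
    (hα : IsPrimitiveRoot α n) (e : Fin n → F) :
    IsCoprime (locator α e) (evaluator α e) := by
  refine IsCoprime.prod_left fun i hi => ?_
  have hlin : (1 - C (α ^ (i.val + 1)) * X : F[X])
      = C (-α ^ (i.val + 1)) * (X - C (pt α i)) := by
    have h := congrArg (C : F → F[X]) (pow_mul_pt hα i)
    rw [C_mul, C_1] at h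
    rw [C_neg]
    linear_combination -h
  have hu : IsUnit (C (-α ^ (i.val + 1)) : F[X]) :=
    isUnit_C.mpr (neg_ne_zero.mpr (pow_ne_zero _ (hα.ne_zero (Fin.pos i).ne'))).isUnit
  rw [hlin, isCoprime_mul_unit_left_left hu]
  refine (irreducible_X_sub_C _).coprime_iff_not_dvd.mpr ?_
  rw [dvd_iff_isRoot, IsRoot, eval_evaluator hα hi]
  exact mul_ne_zero (mem_errorSet.mp hi) (eval_locatorErase_ne_zero hα e i)

theorem fourierCoeff_sub_of_mem_rsCode {F : Type*} [Field F] {n k : ℕ} {α : F} {z w : Fin n → F}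
    (hw : w ∈ rsCode n k α) {l : ℕ} (hl : l < n - k) :
    fourierCoeff α (z - w) l = fourierCoeff α z l := by
  have h := hw l hl
  simp only [fourierCoeff] at h ⊢
  simp [sub_mul, Finset.sum_sub_distrib, h]

/-- The codeword is invisible in the first n - k coefficients, so the syndromes of the received word
are those of the error. -/
theorem X_pow_dvd_fourierPoly_sub {F : Type*} [Field F] {n k : ℕ} {α : F} {z w : Fin n → F}
    (hw : w ∈ rsCode n k α) :
    X ^ (n - k) ∣ fourierPoly α (z - w) n - fourierPoly α z (n - k) := by
  rw [X_pow_dvd_iff]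
  intro d hd
  simp only [fourierPoly, coeff_sub, finsetSum_coeff, coeff_C_mul, coeff_X_pow, mul_ite, mul_one,
    mul_zero, Finset.sum_ite_eq, Finset.mem_range]
  rw [if_pos (by omega), if_pos hd, fourierCoeff_sub_of_mem_rsCode hw hd, sub_self]

/-! ### Interpolation -/

theorem natDegree_sum_monomial_le {F : Type*} [Field F] {D : ℕ} (c : Fin (D + 1) → F[X]) :
    (∑ j, monomial j.val (c j) : F[X][X]).natDegree ≤ D :=
  natDegree_sum_le_of_forall_le _ _ fun j _ =>
    (natDegree_monomial_le _).trans (Nat.lt_succ_iff.mp j.2)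

theorem coeff_sum_monomial {F : Type*} [Field F] {D : ℕ} (c : Fin (D + 1) → F[X])
    (j : Fin (D + 1)) : (∑ j, monomial j.val (c j) : F[X][X]).coeff j = c j := by
  rw [finsetSum_coeff, Finset.sum_eq_single_of_mem j (Finset.mem_univ j)]
  · rw [coeff_monomial, if_pos rfl]
  · intro i _ hij
    rw [coeff_monomial, if_neg (fun h => hij (Fin.ext h))]

/-- The coefficients of `Q(x + x₀, y + y₀)` as linear functionals of `Q`. -/
noncomputable def shiftCoeff {F : Type*} [Field F] (x₀ y₀ : F) (s t : ℕ) : F[X][X] →ₗ[F] F where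
  toFun Q := (((Q.map (compRingHom (X + C x₀))).comp (X + C (C y₀))).coeff t).coeff s
  map_add' P Q := by simp
  map_smul' c Q := by
    have h : c • Q = C (C c) * Q := Algebra.smul_def c Q
    rw [h]
    simp

/-- Counts the linear conditions imposed by multiplicity r at one point. -/
theorem card_fin_sigma_triangle (r : ℕ) :
    (Fintype.card (Σ s : Fin r, Fin (r - s)) : ℚ) = (r : ℚ) * ((r : ℚ) + 1) / 2 := by
  have h := Finset.sum_range_reflect (fun i => i + 1) r
  rw [Fintype.card_sigma]
  simp only [Fintype.card_fin]
  rw [Fin.sum_univ_eq_sum_range (fun i => r - i) r]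
  have h2 : ∑ i ∈ Finset.range r, (r - i) = ∑ i ∈ Finset.range r, (i + 1) := by
    rw [← h]
    refine Finset.sum_congr rfl fun i hi => ?_
    have := Finset.mem_range.mp hi
    omega
  rw [h2]
  clear h h2
  induction r with
  | zero => simp
  | succ r ih => rw [Finset.sum_range_succ]; push_cast at ih ⊢; rw [ih]; ring

/-- Interpolation by counting unknowns and equations: `K j` bounds the degree of the coefficient of
`y ^ j`. -/
theorem exists_interpolation {F : Type*} [Field F] {ι : Type*} [Fintype ι] (x y : ι → F)
    (r : ι → ℕ) (K : ℕ → ℕ) (D : ℕ)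
    (h : ∑ i, (r i : ℚ) * ((r i : ℚ) + 1) / 2 < ∑ j ∈ Finset.range (D + 1), (K j : ℚ)) :
    ∃ Q : F[X][X], Q ≠ 0 ∧ Q.natDegree ≤ D ∧
      (∀ j ≤ D, (Q.coeff j).degree < (K j : WithBot ℕ)) ∧
      ∀ i, HasMultiplicity Q (x i) (y i) (r i) := by
  let build : (Π j : Fin (D + 1), Fin (K j) → F) →ₗ[F] F[X][X] :=
    ∑ j : Fin (D + 1), (monomial (R := F[X]) j.val).restrictScalars F ∘ₗ
      (degreeLT F (K j)).subtype ∘ₗ (degreeLTEquiv F (K j)).symm.toLinearMap ∘ₗ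
        LinearMap.proj j
  have hbuild : ∀ c, build c
      = ∑ j : Fin (D + 1), monomial j.val ((degreeLTEquiv F (K j)).symm (c j)).1 := by
    intro c
    simp [build]
  let T : (Π j : Fin (D + 1), Fin (K j) → F) →ₗ[F]
      ((Σ i : ι, Σ s : Fin (r i), Fin (r i - s)) → F) :=
    LinearMap.pi fun a => shiftCoeff (x a.1) (y a.1) a.2.1 a.2.2 ∘ₗ build
  -- `T` maps the free coefficients of Q to all multiplicity conditions; more unknowns than
  -- equations leave a non-zero kernel.
  have hker : LinearMap.ker T ≠ ⊥ := by
    apply LinearMap.ker_ne_bot_of_finrank_lt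
    rw [Module.finrank_fintype_fun_eq_card, Module.finrank_pi_fintype, Fintype.card_sigma]
    simp only [Module.finrank_fintype_fun_eq_card, Fintype.card_fin]
    rw [Fin.sum_univ_eq_sum_range K (D + 1), ← Nat.cast_lt (α := ℚ)]
    push_cast
    simpa only [card_fin_sigma_triangle] using h
  obtain ⟨c, hc, hc0⟩ := (Submodule.ne_bot_iff _).mp hker
  refine ⟨build c, ?_, ?_, ?_, ?_⟩
  · intro h0
    apply hc0
    funext j
    have := coeff_sum_monomial (fun j => ((degreeLTEquiv F (K j)).symm (c j)).1) j
    rw [← hbuild, h0, coeff_zero] at this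
    have h1 : (degreeLTEquiv F (K j)).symm (c j) = 0 := Subtype.ext this.symm
    exact (LinearEquiv.map_eq_zero_iff _).mp h1
  · rw [hbuild]
    exact natDegree_sum_monomial_le _
  · intro j hj
    have := coeff_sum_monomial (fun j => ((degreeLTEquiv F (K j)).symm (c j)).1)
      ⟨j, Nat.lt_succ_of_le hj⟩
    rw [← hbuild] at this
    simp only at this
    rw [this]
    exact mem_degreeLT.mp (Subtype.property _)
  · intro i s t hst
    have := congrFun (LinearMap.mem_ker.mp hc) ⟨i, ⟨s, by omega⟩, ⟨t, by simp only; omega⟩⟩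
    exact this

/-- If `Q` has multiplicity `r` at `(x₀, y₀)` and the polynomial `Y` takes the value `y₀` at `x₀`,
then `Q(x, Y(x))` vanishes to order `r` at `x₀`. -/
theorem HasMultiplicity.pow_dvd_eval {F : Type*} [Field F] {Q : F[X][X]} {x₀ y₀ : F} {r : ℕ}
    (h : HasMultiplicity Q x₀ y₀ r) {Y : F[X]} (hY : Y.eval x₀ = y₀) :
    (X - C x₀) ^ r ∣ Q.eval Y := by
  set φ : F[X] →+* F[X] := compRingHom (X + C x₀) with hφ
  set R := (Q.map φ).comp (X + C (C y₀)) with hR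
  have hQ : φ (Q.eval Y) = R.eval (φ Y - C y₀) := by
    rw [hR, eval_comp, eval_add, eval_X, eval_C, sub_add_cancel, eval_map, eval₂_at_apply]
  have hroot : X ∣ φ Y - C y₀ := by
    rw [X_dvd_iff, coeff_zero_eq_eval_zero, hφ]
    simp [hY]
  have hdvd : X ^ r ∣ R.eval (φ Y - C y₀) := by
    rw [eval_eq_sum_range]
    refine Finset.dvd_sum fun t _ => ?_
    -- The missing r - t powers of x come from the multiplicity, the other t from the power of Y -
    -- y₀.
    have ht : X ^ (r - t) ∣ R.coeff t := by
      rw [X_pow_dvd_iff]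
      intro s hs
      exact h s t (by omega)
    refine (pow_dvd_pow X (by omega : r ≤ (r - t) + t)).trans ?_
    rw [pow_add]
    exact mul_dvd_mul ht (pow_dvd_pow_of_dvd hroot t)
  rw [← hQ] at hdvd
  have := map_dvd (compRingHom (X - C x₀)) hdvd
  have hinv : compRingHom (X - C x₀) (φ (Q.eval Y)) = Q.eval Y := by
    simp [hφ, comp_assoc]
  rw [hinv] at this
  simpa using this

/-- The quotient W/U need not be a polynomial, but U is invertible modulo (x - x₀)^r. With T its
inverse, W/U may be replaced by the polynomial W T. -/
theorem HasMultiplicity.pow_dvd_sum {F : Type*} [Field F] {Q : F[X][X]} {x₀ y₀ : F} {r D : ℕ}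
    (h : HasMultiplicity Q x₀ y₀ r) (hD : Q.natDegree ≤ D) {U W : F[X]} (hU : U.eval x₀ ≠ 0)
    (hW : W.eval x₀ = y₀ * U.eval x₀) :
    (X - C x₀) ^ r ∣ ∑ j ∈ Finset.range (D + 1), Q.coeff j * W ^ j * U ^ (D - j) := by
  have hcop : IsCoprime ((X - C x₀) ^ r) U := by
    refine IsCoprime.pow_left ((irreducible_X_sub_C _).coprime_iff_not_dvd.mpr ?_)
    rwa [dvd_iff_isRoot]
  by_cases hr : r = 0
  · simp [hr]
  obtain ⟨A, T, hAT⟩ := hcop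
  have hT : T.eval x₀ * U.eval x₀ = 1 := by
    have := congrArg (eval x₀) hAT
    simpa [hr] using this
  have hY : (W * T).eval x₀ = y₀ := by
    rw [eval_mul, hW, mul_assoc, mul_comm (U.eval x₀), hT, mul_one]
  have h1 := h.pow_dvd_eval hY
  have h2 : (X - C x₀) ^ r ∣ ∑ j ∈ Finset.range (D + 1), Q.coeff j * W ^ j * U ^ (D - j)
      - U ^ D * Q.eval (W * T) := by
    rw [eval_eq_sum_range' (Nat.lt_succ_of_le hD), Finset.mul_sum, ← Finset.sum_sub_distrib]
    refine Finset.dvd_sum fun j hj => ?_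
    have hj' : D = (D - j) + j := by have := Finset.mem_range.mp hj; omega
    have h3 : Q.coeff j * W ^ j * U ^ (D - j) - U ^ D * (Q.coeff j * (W * T) ^ j)
        = Q.coeff j * W ^ j * U ^ (D - j) * (1 ^ j - (T * U) ^ j) := by
      conv_lhs => rw [show U ^ D = U ^ (D - j) * U ^ j by rw [← pow_add, ← hj']]
      ring
    rw [h3]
    refine Dvd.dvd.mul_left (dvd_trans ?_ (sub_dvd_pow_sub_pow _ _ j)) _
    exact ⟨A, by linear_combination -hAT⟩
  exact (dvd_sub_left (h1.mul_left _)).mp h2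

theorem aeval_div_eq_zero {F : Type*} [Field F] {Q : F[X][X]} {D : ℕ} (hD : Q.natDegree ≤ D)
    {U W : F[X]} (hU : U ≠ 0)
    (h : ∑ j ∈ Finset.range (D + 1), Q.coeff j * W ^ j * U ^ (D - j) = 0) :
    aeval (algebraMap F[X] (RatFunc F) W / algebraMap F[X] (RatFunc F) U) Q = 0 := by
  have hU' : algebraMap F[X] (RatFunc F) U ≠ 0 := RatFunc.algebraMap_ne_zero hU
  have h' := congrArg (algebraMap F[X] (RatFunc F)) h
  rw [map_zero, map_sum] at h'
  refine (mul_eq_zero.mp (?_ : algebraMap F[X] (RatFunc F) U ^ D * _ = 0)).resolve_left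
    (pow_ne_zero _ hU')
  rw [aeval_eq_sum_range' (Nat.lt_succ_of_le hD), Finset.mul_sum, ← h']
  refine Finset.sum_congr rfl fun j hj => ?_
  have hj' : D = (D - j) + j := by have := Finset.mem_range.mp hj; omega
  rw [Algebra.smul_def, map_mul, map_mul, map_pow, map_pow]
  conv_lhs => rw [show algebraMap F[X] (RatFunc F) U ^ D
    = algebraMap F[X] (RatFunc F) U ^ (D - j) * algebraMap F[X] (RatFunc F) U ^ j by
      rw [← pow_add, ← hj'], div_pow]
  field_simp

/-- A quotient `W / U` is a root of every bivariate polynomial passing with sufficient total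
multiplicity through points of its graph, relative to the weighted degree of the polynomial. -/
theorem sum_eq_zero_of_hasMultiplicity {F : Type*} [Field F] {ι : Type*} {I : Finset ι}
    {x y : ι → F} (hx : Function.Injective x) {r : ι → ℕ} {Q : F[X][X]} {D : ℕ}
    (hD : Q.natDegree ≤ D) {U W : F[X]} (hU : ∀ i ∈ I, U.eval (x i) ≠ 0)
    (hW : ∀ i ∈ I, W.eval (x i) = y i * U.eval (x i))
    (hQ : ∀ i ∈ I, HasMultiplicity Q (x i) (y i) (r i))
    (hdeg : ∀ j ≤ D, (Q.coeff j * W ^ j * U ^ (D - j)).degree < ((∑ i ∈ I, r i : ℕ) : WithBot ℕ)) :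
    ∑ j ∈ Finset.range (D + 1), Q.coeff j * W ^ j * U ^ (D - j) = 0 := by
  have hdvd : ∏ i ∈ I, (X - C (x i)) ^ r i ∣
      ∑ j ∈ Finset.range (D + 1), Q.coeff j * W ^ j * U ^ (D - j) := by
    refine Finset.prod_dvd_of_coprime ?_ fun i hi => (hQ i hi).pow_dvd_sum hD (hU i hi) (hW i hi)
    intro i _ j _ hij
    exact (pairwise_coprime_X_sub_C hx hij).pow
  refine eq_zero_of_dvd_of_degree_lt hdvd ?_
  have h1 : (∏ i ∈ I, (X - C (x i)) ^ r i : F[X]).degree = ((∑ i ∈ I, r i : ℕ) : WithBot ℕ) := by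
    simp [degree_prod, degree_pow]
  rw [h1, degree_lt_iff_coeff_zero]
  intro d hd
  rw [finsetSum_coeff]
  refine Finset.sum_eq_zero fun j hj => coeff_eq_zero_of_degree_lt ?_
  exact (hdeg j (Nat.lt_succ_iff.mp (Finset.mem_range.mp hj))).trans_le (by exact_mod_cast hd)

/-- Interpolation with a root `W / U` of the interpolation polynomial: `ωU` and `ωW` bound the
degrees of `U` and `W`. -/
theorem exists_interpolation_aeval_eq_zero {F : Type*} [Field F] {ι : Type*} [Fintype ι]
    (x y : ι → F) (r : ι → ℕ) {κ : Type*} {I : Finset κ} {x' : κ → F}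
    (hx' : Function.Injective x') (f : κ → ι) (hf : ∀ i ∈ I, x (f i) = x' i) {U W : F[X]}
    (hU0 : U ≠ 0) (hU : ∀ i ∈ I, U.eval (x' i) ≠ 0)
    (hW : ∀ i ∈ I, W.eval (x' i) = y (f i) * U.eval (x' i)) {ωU ωW : ℚ}
    (hωU : (U.natDegree : ℚ) ≤ ωU) (hωW : W ≠ 0 → (W.natDegree : ℚ) ≤ ωW) (D : ℕ)
    (hcount : ∑ i, (r i : ℚ) * ((r i : ℚ) + 1) / 2
      < ((D : ℚ) + 1) * (∑ i ∈ I, (r (f i) : ℚ) - D * ((ωU + ωW) / 2))) :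
    ∃ Q : F[X][X], Q ≠ 0 ∧ Q.natDegree ≤ D ∧ (∀ i, HasMultiplicity Q (x i) (y i) (r i)) ∧
      aeval (algebraMap F[X] (RatFunc F) W / algebraMap F[X] (RatFunc F) U) Q = 0 := by
  set J : ℕ := ∑ i ∈ I, r (f i) with hJ
  have hJ' : ∑ i ∈ I, (r (f i) : ℚ) = J := by rw [hJ]; push_cast; rfl
  rw [hJ'] at hcount
  -- The number of summands is decoupled from D, which must stay fixed during the induction.
  have hsum : ∀ m : ℕ, ∑ j ∈ Finset.range (m + 1), ((J : ℚ) - j * ωW - (D - j) * ωU)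
      = (m + 1) * (J - D * ωU - m * ((ωW - ωU) / 2)) := by
    intro m
    induction m with
    | zero => simp
    | succ m ih => rw [Finset.sum_range_succ, ih]; push_cast; ring
  obtain ⟨Q, hQ0, hQD, hQdeg, hQm⟩ := exists_interpolation x y r
    -- The largest degree bound keeping the j-th term of the homogenised sum below degree J;
    -- rounding up and truncating at 0 only add unknowns.
    (fun j => ⌈(J : ℚ) - j * ωW - (D - j) * ωU⌉₊) D (by
      refine hcount.trans_le (le_trans (le_of_eq ?_) (Finset.sum_le_sum fun j _ => Nat.le_ceil _))
      rw [hsum]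
      ring)
  refine ⟨Q, hQ0, hQD, hQm, aeval_div_eq_zero hQD hU0 ?_⟩
  refine sum_eq_zero_of_hasMultiplicity hx' hQD hU hW
    (fun i hi => hf i hi ▸ hQm (f i)) fun j hj => ?_
  rw [← hJ]
  by_cases hq : Q.coeff j = 0
  · simp [hq]
  have hK := hQdeg j hj
  rw [degree_eq_natDegree hq, Nat.cast_lt, Nat.lt_ceil] at hK
  have hcast : ((D - j : ℕ) : ℚ) = (D : ℚ) - j := Nat.cast_sub hj
  have hb1 : ((D - j : ℕ) : ℚ) * (U.natDegree : ℚ) ≤ ((D : ℚ) - j) * ωU := by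
    rw [← hcast]
    exact mul_le_mul_of_nonneg_left hωU (Nat.cast_nonneg _)
  by_cases hWj : W ^ j = 0
  · simp [hWj]
  have hb2 : (j : ℚ) * (W.natDegree : ℚ) ≤ j * ωW := by
    rcases Nat.eq_zero_or_pos j with rfl | hj0
    · simp
    · have hW0 : W ≠ 0 := fun h => hWj (by rw [h, zero_pow hj0.ne'])
      exact mul_le_mul_of_nonneg_left (hωW hW0) (Nat.cast_nonneg _)
  rw [degree_eq_natDegree (mul_ne_zero (mul_ne_zero hq hWj) (pow_ne_zero _ hU0)), Nat.cast_lt,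
    natDegree_mul (mul_ne_zero hq hWj) (pow_ne_zero _ hU0), natDegree_mul hq hWj, natDegree_pow,
    natDegree_pow, ← Nat.cast_lt (α := ℚ)]
  push_cast
  linarith

/-! ### Values and derivatives of rational functions -/

/-- Values and derivatives are defined on the reduced fraction; this relation carries them over to
any other fraction. -/
theorem num_mul_eq_mul_denom {F : Type*} [Field F] (p : F[X]) {f : F[X]} (hf : f ≠ 0) :
    (algebraMap F[X] (RatFunc F) p / algebraMap F[X] (RatFunc F) f).num * f
      = p * (algebraMap F[X] (RatFunc F) p / algebraMap F[X] (RatFunc F) f).denom := by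
  set r := algebraMap F[X] (RatFunc F) p / algebraMap F[X] (RatFunc F) f with hr
  apply RatFunc.algebraMap_injective F
  have h := RatFunc.num_div_denom r
  have hd : algebraMap F[X] (RatFunc F) r.denom ≠ 0 := RatFunc.algebraMap_ne_zero r.denom_ne_zero
  have hf' : algebraMap F[X] (RatFunc F) f ≠ 0 := RatFunc.algebraMap_ne_zero hf
  rw [map_mul, map_mul]
  rwa [hr, div_eq_div_iff hd hf'] at h

theorem ratEval_div {F : Type*} [Field F] (p : F[X]) {f : F[X]} {x : F} (hx : f.eval x ≠ 0) :
    ratEval x (algebraMap F[X] (RatFunc F) p / algebraMap F[X] (RatFunc F) f)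
      = p.eval x / f.eval x := by
  have hf : f ≠ 0 := by rintro rfl; simp at hx
  have h := congrArg (eval x) (num_mul_eq_mul_denom p hf)
  have hd : (algebraMap F[X] (RatFunc F) p / algebraMap F[X] (RatFunc F) f).denom.eval x ≠ 0 := by
    obtain ⟨q, hq⟩ := RatFunc.denom_div_dvd p f
    intro h0
    rw [hq, eval_mul, h0, zero_mul] at hx
    exact hx rfl
  rw [eval_mul, eval_mul] at h
  change eval x _ / eval x _ = _
  rw [div_eq_div_iff hd hx, h]

theorem ratDeriv_div {F : Type*} [Field F] (p : F[X]) {f : F[X]} (hf : f ≠ 0) :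
    ratDeriv (algebraMap F[X] (RatFunc F) p / algebraMap F[X] (RatFunc F) f)
      = algebraMap F[X] (RatFunc F) (derivative p * f - p * derivative f) /
        algebraMap F[X] (RatFunc F) (f ^ 2) := by
  have h := num_mul_eq_mul_denom p hf
  set r := algebraMap F[X] (RatFunc F) p / algebraMap F[X] (RatFunc F) f with hr
  have h' := congrArg derivative h
  rw [derivative_mul, derivative_mul] at h'
  have hd : algebraMap F[X] (RatFunc F) (r.denom ^ 2) ≠ 0 :=
    RatFunc.algebraMap_ne_zero (pow_ne_zero _ r.denom_ne_zero)
  have hf' : algebraMap F[X] (RatFunc F) (f ^ 2) ≠ 0 :=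
    RatFunc.algebraMap_ne_zero (pow_ne_zero _ hf)
  rw [ratDeriv, ← map_pow, div_eq_div_iff hd hf', ← map_mul, ← map_mul]
  congr 1
  linear_combination (r.denom * f) * h'
    - (f * derivative r.denom + r.denom * derivative f) * h

/-! ### Derivatives in characteristic two -/

theorem derivative_derivative_of_charTwo {F : Type*} [Field F] [CharP F 2] (p : F[X]) :
    derivative (derivative p) = 0 := by
  ext d
  rw [coeff_derivative, coeff_derivative, mul_assoc]
  have h : ((d + 1 : ℕ) : F) + 1 = d := by
    push_cast
    linear_combination CharTwo.two_eq_zero (R := F)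
  have h2 : (d : F) * (d + 1) = 0 := by
    rw [← Nat.cast_succ, ← Nat.cast_mul, CharP.cast_eq_zero_iff F 2]
    exact (Nat.even_mul_succ_self d).two_dvd
  rw [h, h2]
  simp

/-- Over a perfect field of characteristic two, every derivative is a square. -/
theorem exists_sq_eq_derivative {F : Type*} [Field F] [CharP F 2] [PerfectRing F 2] (p : F[X]) :
    ∃ W : F[X], W ^ 2 = derivative p ∧ (W ≠ 0 → 2 * W.natDegree + 1 ≤ p.natDegree) := by
  obtain ⟨W, hW⟩ : ∃ W : F[X], W ^ 2 = derivative p := by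
    -- The derivative has only even exponents, so its root is found by halving them and taking
    -- square roots of the coefficients.
    refine ⟨(contract 2 (derivative p)).map (frobeniusEquiv F 2).symm.toRingHom, ?_⟩
    rw [← map_frobenius_expand, ← map_expand, map_map,
      expand_contract 2 (derivative_derivative_of_charTwo p) two_ne_zero]
    have h : (frobenius F 2).comp (frobeniusEquiv F 2).symm.toRingHom = RingHom.id F :=
      RingHom.ext fun x => frobenius_apply_frobeniusEquiv_symm F 2 x
    rw [h, Polynomial.map_id]
  refine ⟨W, hW, fun hW0 => ?_⟩
  have hp : p.natDegree ≠ 0 := by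
    intro h
    rw [derivative_of_natDegree_zero h] at hW
    exact hW0 (pow_eq_zero_iff two_ne_zero |>.mp hW)
  have := natDegree_derivative_lt hp
  rw [← hW, natDegree_pow] at this
  omega

/-! ### The decomposition -/

theorem IsOutput.exists_cofactors {F : Type*} [Field F] [CharP F 2] {S : F[X]} {N : ℕ}
    {A B : Register F} (h : IsOutput S N A B) {Λ Ω : F[X]} (hS : X ^ N ∣ Λ * S - Ω) :
    ∃ u v : F[X], X ^ N * u = B.comp * Λ + B.conn * Ω ∧ X ^ N * v = A.conn * Ω + A.comp * Λ ∧
      Λ = A.conn * u + B.conn * v ∧ Ω = A.comp * u + B.comp * v := by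
  have two := two_eq_zero_of_charTwo (F := F)
  obtain ⟨k, hk⟩ := hS
  obtain ⟨l, hl⟩ := h.key_left
  obtain ⟨r, hr⟩ := h.key_right
  have hu : B.comp * Λ + B.conn * Ω = X ^ N * (Λ * r - B.conn * k) := by
    linear_combination Λ * hr - B.conn * hk
  have hv : A.conn * Ω + A.comp * Λ = X ^ N * (Λ * l - A.conn * k) := by
    linear_combination Λ * hl - A.conn * hk
  have hX : (X ^ N : F[X]) ≠ 0 := pow_ne_zero _ X_ne_zero
  have hdet := h.det
  refine ⟨_, _, hu.symm, hv.symm, mul_left_cancel₀ hX ?_, mul_left_cancel₀ hX ?_⟩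
  · linear_combination A.conn * hu + B.conn * hv - Λ * hdet - (A.conn * B.conn * Ω) * two
  · linear_combination A.comp * hu + B.comp * hv - Ω * hdet - (A.comp * B.comp * Λ) * two

/-- Both products have degree below L + t, so N + deg u < L + t; with L + L' = N + 1 the strict
inequality becomes deg u ≤ t - L'. -/
theorem degree_cofactor_le {F : Type*} [Field F] {N L L' t : ℕ} {p q Λ Ω u : F[X]}
    (hL : L' + L = N + 1) (hp : p.degree ≤ (L : WithBot ℕ)) (hq : q.degree < (L : WithBot ℕ))
    (hΛ : Λ.degree = (t : WithBot ℕ)) (hΩ : Ω.degree < (t : WithBot ℕ))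
    (hu : X ^ N * u = q * Λ + p * Ω) : u.degree + (L' : WithBot ℕ) ≤ Λ.degree := by
  by_cases hu0 : u = 0
  · simp [hu0]
  have h1 : (q * Λ).degree < ((L + t : ℕ) : WithBot ℕ) := by
    rw [degree_mul, hΛ, Nat.cast_add]
    exact WithBot.add_lt_add_right (WithBot.natCast_ne_bot t) hq
  have h2 : (p * Ω).degree < ((L + t : ℕ) : WithBot ℕ) := by
    by_cases hΩ0 : Ω = 0
    · rw [hΩ0, mul_zero, degree_zero]; exact WithBot.bot_lt_coe _
    by_cases hp0 : p = 0
    · rw [hp0, zero_mul, degree_zero]; exact WithBot.bot_lt_coe _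
    rw [degree_eq_natDegree hp0, Nat.cast_le] at hp
    rw [degree_eq_natDegree hΩ0, Nat.cast_lt] at hΩ
    rw [degree_mul, degree_eq_natDegree hp0, degree_eq_natDegree hΩ0]
    exact_mod_cast add_lt_add_of_le_of_lt hp hΩ
  have h3 := (degree_add_le (q * Λ) (p * Ω)).trans_lt (max_lt h1 h2)
  rw [← hu, degree_mul, degree_X_pow, degree_eq_natDegree hu0] at h3
  rw [hΛ, degree_eq_natDegree hu0]
  have h4 : N + u.natDegree < L + t := by exact_mod_cast h3
  exact_mod_cast (by omega : u.natDegree + L' ≤ t)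

theorem IsOutput.existsUnique_isDecomposition {F : Type*} [Field F] [CharP F 2] {S : F[X]} {N : ℕ}
    {A B : Register F} (h : IsOutput S N A B) {Λ Ω : F[X]} (hS : X ^ N ∣ Λ * S - Ω) {t : ℕ}
    (hΛ : Λ.degree = (t : WithBot ℕ)) (hΩ : Ω.degree < (t : WithBot ℕ)) (hcop : IsCoprime Λ Ω)
    (hone : Λ.coeff 0 = 1) :
    ∃! uv : F[X] × F[X], IsDecomposition A B Λ Ω uv.1 uv.2 := by
  have two := two_eq_zero_of_charTwo (F := F)
  obtain ⟨u, v, hu, hv, hΛe, hΩe⟩ := h.exists_cofactors hS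
  have hconst : A.conn.coeff 0 * u.coeff 0 + B.conn.coeff 0 * v.coeff 0 = 1 := by
    have := congrArg (fun p => coeff p 0) hΛe
    simpa [hone, mul_coeff_zero] using this.symm
  refine ⟨(u, v), ⟨hΛe, hΩe, ?_, ?_, ?_, ?_, ?_⟩, ?_⟩
  · exact degree_cofactor_le h.len_add h.bounded_right.conn_le h.bounded_right.comp_lt hΛ hΩ hu
  · refine degree_cofactor_le (by rw [add_comm]; exact h.len_add) h.bounded_left.conn_le
      h.bounded_left.comp_lt hΛ hΩ ?_
    rw [hv, add_comm]
  · obtain ⟨x, y, hxy⟩ := hcop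
    -- A Bézout identity for Λ and Ω becomes one for u and v by substitution.
    refine ⟨x * A.conn + y * A.comp, x * B.conn + y * B.comp, ?_⟩
    linear_combination hxy - x * hΛe - y * hΩe
  · intro hA
    rcases h.coeff_zero with ⟨h1, h2⟩ | ⟨h1, h2⟩
    · simpa [h1, h2] using hconst
    · exact absurd h1 hA
  · intro hB
    rcases h.coeff_zero with ⟨h1, h2⟩ | ⟨h1, h2⟩
    · exact absurd h2 hB
    · simpa [h1, h2] using hconst
  -- The two linear equations alone determine the pair, since the determinant is non-zero.
  · rintro ⟨u', v'⟩ ⟨hΛ', hΩ', -, -, -, -, -⟩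
    simp only at hΛ' hΩ'
    have hX : (X ^ N : F[X]) ≠ 0 := pow_ne_zero _ X_ne_zero
    have hdet := h.det
    refine Prod.ext (mul_left_cancel₀ hX ?_) (mul_left_cancel₀ hX ?_)
    · simp only
      linear_combination (-u') * hdet - hu - B.comp * hΛ' - B.conn * hΩ'
        - (B.comp * B.conn * v') * two
    · simp only
      linear_combination (-v') * hdet - hv - A.conn * hΩ' - A.comp * hΛ'
        - (A.comp * A.conn * u') * two

/-! ### The rational interpolation problem -/

/-- The variables are values at one error location. There V/U = -p/f, while the two derivatives
differ by Λ'/(fU), which Forney's formula expresses through q and r. -/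
theorem deriv_quotient_eq {F : Type*} [Field F] {x e p f q r U V p' f' U' V' Λ' : F}
    (hx : x ≠ 0) (he : e ≠ 0) (hf : f ≠ 0) (hU : U ≠ 0) (hroot : p * U + f * V = 0)
    (hΛ' : Λ' = p' * U + p * U' + (f' * V + f * V'))
    (hforney : e * x * Λ' = -(q * U + r * V)) :
    (V' * U - V * U') / U ^ 2
      = -(e * x)⁻¹ * ((q * f - p * r) / f ^ 2) + (-p' * f - -p * f') / f ^ 2 := by
  have hV : V = -(p * U) / f := by
    rw [eq_div_iff hf]; linear_combination hroot
  subst hΛ'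
  have h2 : (q * f - p * r) = -(e * x * (p' * U + p * U' + (f' * V + f * V'))) * f / U := by
    rw [eq_div_iff hU]
    linear_combination f * hforney - r * hroot
  rw [h2, hV]
  field_simp
  ring

/-- Treats all θ at once: V/U is g, -p/f is h, and l, l' are the degree savings of U and V. -/
theorem exists_interpolation_of_decomposition {F : Type*} [Field F] [Fintype F] [CharP F 2] {n : ℕ}
    (hn : n = Fintype.card F - 1) (hn0 : n ≠ 0) {α : F} (hα : IsPrimitiveRoot α n) {e : Fin n → F}
    {p f q r U V : F[X]} (hΛ : locator α e = p * U + f * V) (hΩ : evaluator α e = q * U + r * V)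
    (hcop : IsCoprime U V) (hf : ∀ i : Fin n, f.eval (pt α i) ≠ 0) (hI : (errorSet e).Nonempty)
    {P : F → F → F}
    (hP : ∀ x y, P x y
      = -(y * x)⁻¹ * ratEval x (algebraMap F[X] (RatFunc F) (q * f - p * r) /
          algebraMap F[X] (RatFunc F) (f ^ 2))
        + ratEval x (ratDeriv (algebraMap F[X] (RatFunc F) (-p) / algebraMap F[X] (RatFunc F) f)))
    (M : F → F → ℕ) (D : ℕ) {l l' : ℕ} (hUdeg : U.natDegree + l ≤ (locator α e).natDegree)
    (hVdeg : V.natDegree + l' ≤ (locator α e).natDegree)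
    (hcount : (cost n α M + 1) / ((D : ℚ) + 1)
        + (D : ℚ) * (((locator α e).natDegree : ℚ) - (3 * (l : ℚ) + (l' : ℚ) + 1) / 4)
        ≤ ∑ i ∈ errorSet e, (M (pt α i) (e i) : ℚ)) :
    ∃ Q : F[X][X], Q ≠ 0 ∧ Q.natDegree ≤ D ∧
        (∀ i j : Fin n,
          HasMultiplicity Q (pt α i) ((frobeniusEquiv F 2).symm (P (pt α i) (pt α j)))
            (M (pt α i) (pt α j))) ∧
        ∃ s : RatFunc F, s ^ 2 = ratDeriv (algebraMap F[X] (RatFunc F) V /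
          algebraMap F[X] (RatFunc F) U) ∧ aeval s Q = 0 := by
  have two := two_eq_zero_of_charTwo (F := F)
  have hroot : ∀ i ∈ errorSet e,
      p.eval (pt α i) * U.eval (pt α i) + f.eval (pt α i) * V.eval (pt α i) = 0 := by
    intro i hi
    rw [← eval_mul, ← eval_mul, ← eval_add, ← hΛ, eval_locator hα hi]
  have hU : ∀ i ∈ errorSet e, U.eval (pt α i) ≠ 0 := by
    intro i hi h0
    have hV0 : V.eval (pt α i) = 0 := by
      have := hroot i hi
      rw [h0, mul_zero, zero_add] at this
      exact (mul_eq_zero.mp this).resolve_left (hf i)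
    obtain ⟨a, b, hab⟩ := hcop
    have := congrArg (eval (pt α i)) hab
    simp [h0, hV0] at this
  have hU0 : U ≠ 0 := by
    obtain ⟨i, hi⟩ := hI
    intro h
    exact hU i hi (by rw [h, eval_zero])
  obtain ⟨W, hW, hWdeg⟩ := exists_sq_eq_derivative (V * U)
  have hW' : W ^ 2 = derivative V * U - V * derivative U := by
    rw [hW, derivative_mul]
    linear_combination (V * derivative U) * two
  have hvalue : ∀ i ∈ errorSet e, P (pt α i) (e i) = (W.eval (pt α i) / U.eval (pt α i)) ^ 2 := by
    intro i hi
    have hf0 : f ≠ 0 := by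
      intro h
      exact hf i (by rw [h, eval_zero])
    have hf2 : (f ^ 2).eval (pt α i) ≠ 0 := by
      rw [eval_pow]; exact pow_ne_zero _ (hf i)
    have hW2 := congrArg (eval (pt α i)) hW'
    have hder := congrArg (fun g => eval (pt α i) (derivative g)) hΛ
    have hfor := forney hα hi
    have hΩ' := congrArg (eval (pt α i)) hΩ
    simp only [derivative_add, derivative_mul, eval_add, eval_sub, eval_mul, eval_pow]
      at hW2 hder hΩ'
    rw [hΩ'] at hfor
    rw [hP, ratDeriv_div _ hf0, ratEval_div _ hf2, ratEval_div _ hf2, div_pow, hW2,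
      deriv_quotient_eq (pt_ne_zero hα i) (mem_errorSet.mp hi) (hf i) (hU i hi) (hroot i hi) hder
        hfor]
    simp
  -- Every error value is some α^{-j}, so the point to be hit is among the interpolation points;
  -- outside I the index is arbitrary.
  have hidx : ∀ i, ∃ j : Fin n, i ∈ errorSet e → pt α j = e i := by
    intro i
    by_cases hi : i ∈ errorSet e
    · obtain ⟨j, hj⟩ := exists_pt_eq hα hn hn0 (mem_errorSet.mp hi)
      exact ⟨j, fun _ => hj⟩
    · exact ⟨i, fun h => absurd h hi⟩
  choose idx hidx using hidx
  have hcost : ∑ a : Fin n × Fin n, (M (pt α a.1) (pt α a.2) : ℚ)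
      * ((M (pt α a.1) (pt α a.2) : ℚ) + 1) / 2 = cost n α M := by
    rw [cost, Fintype.sum_prod_type]
  have hUq : (U.natDegree : ℚ) ≤ (locator α e).natDegree - l := by
    rw [le_sub_iff_add_le]; exact_mod_cast hUdeg
  have hVq : (V.natDegree : ℚ) ≤ (locator α e).natDegree - l' := by
    rw [le_sub_iff_add_le]; exact_mod_cast hVdeg
  obtain ⟨Q, hQ0, hQD, hQm, hQs⟩ := exists_interpolation_aeval_eq_zero
    (x := fun a : Fin n × Fin n => pt α a.1)
    (y := fun a => (frobeniusEquiv F 2).symm (P (pt α a.1) (pt α a.2)))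
    (r := fun a => M (pt α a.1) (pt α a.2)) (I := errorSet e) (pt_injective hα)
    (fun i => (i, idx i)) (fun _ _ => rfl) hU0 hU (W := W) (by
      intro i hi
      rw [hidx i hi, hvalue i hi, ← frobenius_def, ← coe_frobeniusEquiv, RingEquiv.symm_apply_apply,
        div_mul_cancel₀ _ (hU i hi)])
    (ωU := (locator α e).natDegree - l)
    (ωW := (locator α e).natDegree - ((l : ℚ) + l' + 1) / 2) hUq (by
      intro hW0
      have h1 : (2 * W.natDegree + 1 : ℚ) ≤ V.natDegree + U.natDegree := by
        exact_mod_cast (hWdeg hW0).trans natDegree_mul_le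
      linarith) D (by
      rw [hcost]
      have hsum : ∑ i ∈ errorSet e, (M (pt α i) (pt α (idx i)) : ℚ)
          = ∑ i ∈ errorSet e, (M (pt α i) (e i) : ℚ) :=
        Finset.sum_congr rfl fun i hi => by rw [hidx i hi]
      simp only
      rw [hsum]
      have hD : (0 : ℚ) < D + 1 := by positivity
      have h1 := mul_le_mul_of_nonneg_left hcount hD.le
      rw [mul_add, mul_div_cancel₀ _ hD.ne'] at h1
      linarith)
  refine ⟨Q, hQ0, hQD, fun i j => hQm (i, j), _, ?_, hQs⟩
  rw [ratDeriv_div _ hU0, div_pow, ← map_pow, ← map_pow, hW']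

end RSDecoding

open RSDecoding
theorem theorem9 {F : Type*} [Field F] [Fintype F] [CharP F 2] (m n k : ℕ)
    (hF : Fintype.card F = 2 ^ m) (hn : n = 2 ^ m - 1) (hk : k ≤ n)
    (α : F) (hα : IsPrimitiveRoot α n)
    -- the hard decision, the sent codeword and the error pattern
    (z w e : Fin n → F) (hw : w ∈ rsCode n k α) (he : e = z - w)
    -- the registers `(a, c, L_a)` and `(b, d, L_b)` computed from the received word
    (A B : Register F) (hAB : (A, B) = sortedRegisters (fourierPoly α z (n - k)) (n - k))
    (θ : OnePoint F) (hθ : ∀ i : Fin n, (fPoly A B θ).eval (pt α i) ≠ 0)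
    (M : F → F → ℕ) (DY : ℕ)
    (hdeg : B.len ≤ (locator α e).natDegree)
    (hcount : (cost n α M + 1) / ((DY : ℚ) + 1)
        + (DY : ℚ) * (((locator α e).natDegree : ℚ) - (3 * (A.len : ℚ) + (B.len : ℚ) + 1) / 4)
        ≤ ∑ i ∈ errorSet e, (M (pt α i) (e i) : ℚ))
    (hDY : ((B.len : ℚ) + 1 - (A.len : ℚ)) * (DY : ℚ) * ((DY : ℚ) + 1) / 4 ≤ cost n α M + 1) :
    (∃! uv : F[X] × F[X],
      IsDecomposition A B (locator α e) (evaluator α e) uv.1 uv.2) ∧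
    ∀ u v : F[X], IsDecomposition A B (locator α e) (evaluator α e) u v →
      ∃ Q : F[X][X], Q ≠ 0 ∧ Q.natDegree ≤ DY ∧
        (∀ i j : Fin n,
          HasMultiplicity Q (pt α i)
            ((frobeniusEquiv F 2).symm (pFun A B θ (pt α i) (pt α j)))
            (M (pt α i) (pt α j))) ∧
        ∃ s : RatFunc F, s ^ 2 = ratDeriv (gFun u v θ) ∧ aeval s Q = 0 := by
  have hn' : n = Fintype.card F - 1 := by rw [hF, hn]
  have hn0 : n ≠ 0 := by have := Fintype.one_lt_card (α := F); omega
  have hout : IsOutput (fourierPoly α z (n - k)) (n - k) A B := by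
    have h := isOutput_sortedRegisters (fourierPoly α z (n - k)) (n - k)
    rwa [← hAB] at h
  have hΛdeg := degree_locator hn0 hα e
  have hΛnat : (locator α e).natDegree = (errorSet e).card := natDegree_eq_of_degree_eq_some hΛdeg
  have hlenA := hout.len_add
  have hlenle := hout.len_le
  constructor
  · refine hout.existsUnique_isDecomposition ?_ hΛdeg (degree_evaluator_lt hn0 hα e)
      (isCoprime_locator_evaluator hα e) ?_
    · obtain ⟨c, hc⟩ := X_pow_dvd_fourierPoly_sub (z := z) hw
      rw [← he] at hc
      have hE := locator_mul_fourierPoly_eq_evaluator hn0 hα e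
      have hX : (X ^ n : F[X]) = X ^ (n - k) * X ^ k := by rw [← pow_add, Nat.sub_add_cancel hk]
      rw [hX] at hE
      refine ⟨-(evaluator α e * X ^ k) - locator α e * c, ?_⟩
      linear_combination hE - locator α e * hc
    · simp [locator, coeff_zero_eq_eval_zero, eval_prod]
  · intro u v h
    -- L_a + L_b = n - k + 1 and L_a ≤ L_b give L_b ≥ 1, hence deg Λ ≥ 1.
    have hI : (errorSet e).Nonempty := by
      rw [← Finset.card_pos]; omega
    -- For g = 0 the bound by `degree` is void while `natDegree` is 0; here deg Λ ≥ L_b is needed.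
    have hnat : ∀ {g : F[X]} {L : ℕ}, L ≤ B.len →
        g.degree + (L : WithBot ℕ) ≤ (locator α e).degree →
        g.natDegree + L ≤ (locator α e).natDegree := by
      intro g L hL hg
      by_cases hg0 : g = 0
      · rw [hg0, natDegree_zero, zero_add]; exact hL.trans hdeg
      · rw [degree_eq_natDegree hg0, hΛdeg] at hg
        rw [hΛnat]
        exact_mod_cast hg
    have hu := hnat hlenle h.degree_left
    have hv := hnat le_rfl h.degree_right
    cases θ with
    | infty =>
      -- For θ = ∞ the registers exchange roles; L_a ≤ L_b makes the required inequality weaker than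
      -- the assumed one.
      refine exists_interpolation_of_decomposition (p := B.conn) (f := A.conn) (q := B.comp)
        (r := A.comp) (U := v) (V := u) hn' hn0 hα ?_ ?_ h.coprime.symm hθ hI ?_ M DY hv hu ?_
      · rw [h.locator_eq, add_comm]
      · rw [h.evaluator_eq, add_comm]
      · intro x y
        rw [map_neg, map_pow, mul_comm B.comp]
        rfl
      · refine le_trans ?_ hcount
        have : (A.len : ℚ) ≤ B.len := by exact_mod_cast hlenle
        gcongr ?_ + ?_ * (?_ - ?_ / 4) <;> linarith
    | coe t =>
      -- A unimodular change of basis: (b, d) loses θ(a, c) and u gains θv, so Λ, Ω and the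
      -- determinant are unchanged.
      refine exists_interpolation_of_decomposition (p := A.conn) (f := B.conn - C t * A.conn)
        (q := A.comp) (r := B.comp - C t * A.comp) (U := u + C t * v) (V := v) hn' hn0 hα ?_ ?_ ?_
        hθ hI ?_ M DY ?_ hv hcount
      · rw [h.locator_eq]; ring
      · rw [h.evaluator_eq]; ring
      · exact h.coprime.add_mul_right_left (C t)
      · intro x y
        have hnum : A.comp * (B.conn - C t * A.conn) - A.conn * (B.comp - C t * A.comp)
          = B.conn * A.comp - A.conn * B.comp := by ring
        rw [hnum, map_neg, map_pow]
        rfl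
      · have h1 := natDegree_add_le u (C t * v)
        have h2 := natDegree_C_mul_le t v
        rcases max_cases u.natDegree (C t * v).natDegree with ⟨h3, -⟩ | ⟨h3, -⟩ <;> omega
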